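/- For $c=(c_1,c_2,c_3)\in\mathbb R^3$ consider the equation $$(1-x^2)U'+2xU+\tfrac12U^2=c_1(1-x)+c_2(1+x)+c_3(1-x^2),\qquad -1<x<1. \qquad (\ast)$$ For $c_1,c_2\ge-1$ put $\bar c_3(c_1,c_2)=-\frac12\left(\sqrt{1+c_1}+\sqrt{1+c_2}\right)\left(\sqrt{1+c_1}+\sqrt{1+c_2}+2\right)$, and let $$J=\{c\in\mathbb R^3 : c_1\ge-1,\ c_2\ge-1,\ c_3\ge\bar c_3(c_1,c_2)\}.$$ Put $\tau_1(c_1)=2-2\sqrt{1+c_1}$, $\tau_2(c_1)=2+2\sqrt{1+c_1}$, $\tau_1'(c_2)=-2-2\sqrt{1+c_2}$, $\tau_2'(c_2)=-2+2\sqrt{1+c_2}$. Let $c\in J$. Then $(\ast)$ has a greatest solution $U^+_\theta(c)$ and a least solution $U^-_\theta(c)$: these are solutions in $C^\infty(-1,1)\cap C^0[-1,1]$ such that $U^-_\theta(c)\le U\le U^+_\theta(c)$ in $(-1,1)$ for every solution $U$ of $(\ast)$ in $(-1,1)$. Write $\gamma^\pm(c)=U^\pm_\theta(c)(0)$. For every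 $\gamma$ with $\gamma^-(c)\le\gamma\le\gamma^+(c)$ there is a unique solution $U^{c,\gamma}_\theta\in C^\infty(-1,1)\cap C^0[-1,1]$ of $(\ast)$ with $U^{c,\gamma}_\theta(0)=\gamma$. Moreover: (i) If $c_3>\bar c_3(c_1,c_2)$, then $\gamma^-(c)<\gamma^+(c)$, and for all $\gamma^-(c)\le\gamma<\gamma'\le\gamma^+(c)$ one has $U^{c,\gamma}_\theta<U^{c,\gamma'}_\theta$ in $(-1,1)$. Moreover, $$\{(x,y) : -1<x<1,\ U^{c,\gamma^-(c)}_\theta(x)\le y\le U^{c,\gamma^+(c)}_\theta(x)\}=\bigcup_{\gamma\in[\gamma^-(c),\gamma^+(c)]}\{(x,U^{c,\gamma}_\theta(x)) : -1<x<1\}.$$ (ii) For every $\gamma\in[\gamma^-(c),\gamma^+(c)]$ (also when $c_3=\bar c_3(c_1,c_2)$), $$U^{c,\gamma}_\theta(-1)=\begin{cases}\tau_2(c_1)&\text{if }\gamma=\gamma^+(c),\\ \tau_1(c_1)&\text{otherwise,}\end{cases}\qquad U^{c,\gamma}_\theta(1)=\begin{cases}\tau_1'(c_2)&\text{if }\gamma=\gamma^-(c),\\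 \tau_2'(c_2)&\text{otherwise.}\end{cases}$$ -/

import Mathlib

open Set
open scoped ContDiff

noncomputable section

namespace AxiNS

/-- The right-hand side `P_c(x) = c₁ (1 - x) + c₂ (1 + x) + c₃ (1 - x²)`, where the parameter
`c = (c₁, c₂, c₃) ∈ ℝ³` is indexed from `0`: `c₁ = c 0`, `c₂ = c 1`, `c₃ = c 2`. -/
def P (c : Fin 3 → ℝ) (x : ℝ) : ℝ :=
  c 0 * (1 - x) + c 1 * (1 + x) + c 2 * (1 - x ^ 2)

/-- `U` is a (classical) solution in `(-1,1)` of
`(1 - x²) U' + 2 x U + U² / 2 = P_c(x)`. -/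
def IsSolution (c : Fin 3 → ℝ) (U : ℝ → ℝ) : Prop :=
  ∀ x ∈ Ioo (-1 : ℝ) 1, DifferentiableAt ℝ U x ∧
    (1 - x ^ 2) * deriv U x + 2 * x * U x + (1 / 2) * U x ^ 2 = P c x

/-- A solution of the equation in `(-1,1)` that lies in `C^∞(-1,1) ∩ C⁰[-1,1]`.  Functions on
`[-1,1]` are represented by functions on `ℝ`, whose values outside `[-1,1]` play no role. -/
structure IsRegularSolution (c : Fin 3 → ℝ) (U : ℝ → ℝ) : Prop where
  contDiffOn : ContDiffOn ℝ ∞ U (Ioo (-1) 1)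
  continuousOn : ContinuousOn U (Icc (-1) 1)
  isSolution : IsSolution c U

/-- `c̄₃(c₁,c₂)`. -/
def cbar₃ (c₁ c₂ : ℝ) : ℝ :=
  -(1 / 2) * (√(1 + c₁) + √(1 + c₂)) * (√(1 + c₁) + √(1 + c₂) + 2)

/-- The parameter set `J ⊆ ℝ³`. -/
def J : Set (Fin 3 → ℝ) :=
  {c | -1 ≤ c 0 ∧ -1 ≤ c 1 ∧ cbar₃ (c 0) (c 1) ≤ c 2}

/-- `V` is a solution in `C^∞(-1,1) ∩ C⁰[-1,1]` that lies above every solution in `(-1,1)`.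
It is unique as a function on `[-1,1]`. -/
def IsUpperSolution (c : Fin 3 → ℝ) (V : ℝ → ℝ) : Prop :=
  IsRegularSolution c V ∧ ∀ U, IsSolution c U → ∀ x ∈ Ioo (-1 : ℝ) 1, U x ≤ V x

/-- `V` is a solution in `C^∞(-1,1) ∩ C⁰[-1,1]` that lies below every solution in `(-1,1)`.
It is unique as a function on `[-1,1]`. -/
def IsLowerSolution (c : Fin 3 → ℝ) (V : ℝ → ℝ) : Prop :=
  IsRegularSolution c V ∧ ∀ U, IsSolution c U → ∀ x ∈ Ioo (-1 : ℝ) 1, V x ≤ U x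

open Classical in
/-- The greatest solution `U⁺_θ(c)` (the zero function if there is none). -/
def Uplus (c : Fin 3 → ℝ) : ℝ → ℝ :=
  if h : ∃ V, IsUpperSolution c V then h.choose else 0

open Classical in
/-- The least solution `U⁻_θ(c)` (the zero function if there is none). -/
def Uminus (c : Fin 3 → ℝ) : ℝ → ℝ :=
  if h : ∃ V, IsLowerSolution c V then h.choose else 0

/-- `γ⁺(c) = U⁺_θ(c)(0)`. -/
def γplus (c : Fin 3 → ℝ) : ℝ := Uplus c 0

/-- `γ⁻(c) = U⁻_θ(c)(0)`. -/
def γminus (c : Fin 3 → ℝ) : ℝ := Uminus c 0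

/-- The parameter set `I ⊆ ℝ³ × ℝ`. -/
def I : Set ((Fin 3 → ℝ) × ℝ) :=
  {q | q.1 ∈ J ∧ γminus q.1 ≤ q.2 ∧ q.2 ≤ γplus q.1}

open Classical in
/-- The solution `U^{c,γ}_θ` in `C^∞(-1,1) ∩ C⁰[-1,1]` with value `γ` at `0` (the zero function
if there is none). -/
def Uθ (c : Fin 3 → ℝ) (γ : ℝ) : ℝ → ℝ :=
  if h : ∃ U, IsRegularSolution c U ∧ U 0 = γ then h.choose else 0

def τ₁ (c₁ : ℝ) : ℝ := 2 - 2 * √(1 + c₁)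

def τ₂ (c₁ : ℝ) : ℝ := 2 + 2 * √(1 + c₁)

def τ₁' (c₂ : ℝ) : ℝ := -2 - 2 * √(1 + c₂)

def τ₂' (c₂ : ℝ) : ℝ := -2 + 2 * √(1 + c₂)

end AxiNS

end

open Filter Topology

namespace AxiNS

/-! ### Power series given by a ratio recurrence -/

/-! Write `a = √(1 + c₁)`, `b = √(1 + c₂)`, `δ = c₃ - c̄₃ ≥ 0`. For `δ = 0` the Riccati equation has
an affine solution `A`, with values `τ₂` at `-1` and `τ₁'` at `1`. For general `δ` the substitution
`U = A + 2 (1 - x²) y' / y` gives a linear Jacobi equation. Its power series in `1 + x` has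
nonnegative coefficients and radius at least `2`, so `y > 0` and `y' ≥ 0` on all of `(-1, 1)`. This
yields a solution `M ≥ A` tending to `τ₂` at `-1` (`exists_solution_ge_affineSol`); the symmetry `U
↦ -U(-x)` yields `L ≤ A` tending to `τ₁'` at `1`.

Relative to `L`, the function `1 / (U - L)` solves a first-order linear equation, with homogeneous
solution `G`. Since `L ≤ A`, `G` is bounded near `1`, which forces `1 / (U - L)` to be positive
there, for every solution `U ≠ L`. So `L` is least, and L'Hôpital's rule gives the limit of `U` at
`1` (`IsSolution.lt_and_tendsto`). Reflection treats `M` and the end point `-1`.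

Differences of solutions never change sign, so solutions are ordered and determined by their value
at `0`. Adding nonnegative multiples of `G` to `1 / (M - L)` fills the region between `L` and `M`
(`IsSolution.exists_between`). -/

theorem summable_of_ratio {c ρ : ℕ → ℝ} {R t : ℝ} (hc : ∀ n, c (n + 1) = ρ n * c n)
    (hρ : Tendsto ρ atTop (𝓝 R⁻¹)) (ht : |t| < R) : Summable fun n => c n * t ^ n := by
  have hR : 0 < R := (abs_nonneg t).trans_lt ht
  have hlim : Tendsto (fun n => |ρ n| * |t|) atTop (𝓝 (|R⁻¹| * |t|)) := hρ.abs.mul_const _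
  have hlt : |R⁻¹| * |t| < 1 := by
    rw [abs_of_pos (inv_pos.2 hR), inv_mul_lt_iff₀ hR]
    simpa using ht
  obtain ⟨l, hl, hl1⟩ := exists_between hlt
  refine summable_of_ratio_norm_eventually_le hl1 ?_
  filter_upwards [hlim.eventually_lt_const hl] with n hn
  have : ‖c (n + 1) * t ^ (n + 1)‖ = (|ρ n| * |t|) * ‖c n * t ^ n‖ := by
    rw [hc, pow_succ]
    simp only [norm_mul, Real.norm_eq_abs]
    ring
  rw [this]
  exact mul_le_mul_of_nonneg_right hn.le (norm_nonneg _)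

/-- The coefficients of the derivative of the power series with coefficients `c`. -/
def derivCoeff (c : ℕ → ℝ) (n : ℕ) : ℝ := (n + 1) * c (n + 1)

theorem derivCoeff_ratio {c ρ : ℕ → ℝ} (hc : ∀ n, c (n + 1) = ρ n * c n) (n : ℕ) :
    derivCoeff c (n + 1) = ((n + 2) / (n + 1) * ρ (n + 1)) * derivCoeff c n := by
  have : (n : ℝ) + 1 ≠ 0 := by positivity
  simp only [derivCoeff, hc (n + 1)]
  push_cast
  field_simp
  ring

theorem tendsto_derivCoeff_ratio {ρ : ℕ → ℝ} {l : ℝ} (hρ : Tendsto ρ atTop (𝓝 l)) :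
    Tendsto (fun n : ℕ => ((n : ℝ) + 2) / (n + 1) * ρ (n + 1)) atTop (𝓝 l) := by
  have h1 : Tendsto (fun n : ℕ => 1 + 1 / ((n : ℝ) + 1)) atTop (𝓝 (1 + 0)) :=
    tendsto_const_nhds.add tendsto_one_div_add_atTop_nhds_zero_nat
  have h2 : Tendsto (fun n : ℕ => ρ (n + 1)) atTop (𝓝 l) := hρ.comp (tendsto_add_atTop_nat 1)
  have h3 := h1.mul h2
  rw [add_zero, one_mul] at h3
  refine h3.congr fun n => ?_
  have : (n : ℝ) + 1 ≠ 0 := by positivity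
  congr 1
  field_simp
  ring

/-- The coefficient ratios of the derived series have the same limit, so that series converges
absolutely at some `r` with `|t| < r < R` and dominates the termwise derivatives on `(-r, r)`. -/
theorem hasDerivAt_tsum_pow {c ρ : ℕ → ℝ} {R t : ℝ} (hc : ∀ n, c (n + 1) = ρ n * c n)
    (hρ : Tendsto ρ atTop (𝓝 R⁻¹)) (ht : |t| < R) :
    HasDerivAt (fun s => ∑' n, c n * s ^ n) (∑' n, derivCoeff c n * t ^ n) t := by
  obtain ⟨r, htr, hrR⟩ := exists_between ht
  have hr : 0 < r := (abs_nonneg t).trans_lt htr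
  have hsum : Summable fun n => ‖derivCoeff c n * r ^ n‖ :=
    (summable_of_ratio (derivCoeff_ratio hc) (tendsto_derivCoeff_ratio hρ)
      (by rwa [abs_of_pos hr])).norm
  have hsumt : Summable fun n => derivCoeff c n * t ^ n :=
    summable_of_ratio (derivCoeff_ratio hc) (tendsto_derivCoeff_ratio hρ) ht
  have hshift : ∀ (n : ℕ) (s : ℝ),
      c (n + 1) * (((n + 1 : ℕ) : ℝ) * s ^ (n + 1 - 1)) = derivCoeff c n * s ^ n := by
    intro n s
    simp only [derivCoeff, Nat.add_sub_cancel]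
    push_cast
    ring
  have key := hasDerivAt_tsum_of_isPreconnected (𝕜 := ℝ) (F := ℝ)
    (u := fun n => ‖c n * ((n : ℝ) * r ^ (n - 1))‖)
    (g := fun n s => c n * s ^ n) (g' := fun n s => c n * ((n : ℝ) * s ^ (n - 1)))
    (t := Ioo (-r) r) (y₀ := 0) (y := t) ?_ isOpen_Ioo isPreconnected_Ioo
    (fun n y _ => (hasDerivAt_pow n y).const_mul (c n)) ?_ (by simpa using hr) ?_ (abs_lt.1 htr)
  · rwa [tsum_eq_zero_add' (by simpa only [hshift] using hsumt), Nat.cast_zero, zero_mul, mul_zero,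
      zero_add, tsum_congr fun n => hshift n t] at key
  · rw [← summable_nat_add_iff 1]
    simpa only [hshift] using hsum
  · intro n y hy
    simp only [norm_mul, norm_pow]
    have : ‖y‖ ≤ ‖r‖ := by
      rw [Real.norm_eq_abs, Real.norm_eq_abs, abs_of_pos hr]
      exact (abs_lt.2 hy).le
    gcongr
  · exact summable_of_ratio hc hρ (by simpa using hr.trans hrR)

theorem hasSum_natCast_mul {c d : ℕ → ℝ} {t : ℝ} (hd : ∀ n, d n = derivCoeff c n)
    (hs : Summable fun n => d n * t ^ n) :
    HasSum (fun n : ℕ => (n : ℝ) * c n * t ^ n) (t * ∑' n, d n * t ^ n) := by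
  rw [← hasSum_nat_add_iff' 1]
  have h0 : t * ∑' n, d n * t ^ n - ∑ i ∈ Finset.range 1, (i : ℝ) * c i * t ^ i =
      t * ∑' n, d n * t ^ n := by simp
  rw [h0]
  refine (hs.hasSum.mul_left t).congr_fun fun n => ?_
  rw [hd, derivCoeff]
  push_cast
  ring

/-! ### A Jacobi equation -/

/-- The ratio of consecutive coefficients of the solution of the Jacobi equation that is
regular at `-1`. -/
noncomputable def jacobiRatio (a b δ : ℝ) (n : ℕ) : ℝ :=
  (n * (n + a + b + 1) + δ / 2) / (2 * (n + 1) * (n + a + 1))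

noncomputable def jacobiCoeff (a b δ : ℝ) : ℕ → ℝ
  | 0 => 1
  | n + 1 => jacobiRatio a b δ n * jacobiCoeff a b δ n

theorem tendsto_jacobiRatio (a b δ : ℝ) :
    Tendsto (jacobiRatio a b δ) atTop (𝓝 (2 : ℝ)⁻¹) := by
  have hinv : Tendsto (fun n : ℕ => ((n : ℝ))⁻¹) atTop (𝓝 0) :=
    tendsto_inv_atTop_zero.comp tendsto_natCast_atTop_atTop
  have h1 : Tendsto (fun n : ℕ => ((1 + (a + b + 1) * (n : ℝ)⁻¹) + δ / 2 * ((n : ℝ)⁻¹ * (n : ℝ)⁻¹)) /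
      (2 * (1 + (n : ℝ)⁻¹) * (1 + (a + 1) * (n : ℝ)⁻¹))) atTop
      (𝓝 (((1 + (a + b + 1) * 0) + δ / 2 * (0 * 0)) / (2 * (1 + 0) * (1 + (a + 1) * 0)))) := by
    refine Tendsto.div ?_ ?_ (by norm_num)
    · exact ((hinv.const_mul _).const_add _).add ((hinv.mul hinv).const_mul _)
    · exact ((hinv.const_add _).const_mul _).mul ((hinv.const_mul _).const_add _)
  norm_num at h1
  refine (h1.congr' ?_).trans (by norm_num)
  filter_upwards [eventually_gt_atTop 0] with n hn
  have hn' : (n : ℝ) ≠ 0 := by positivity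
  rw [jacobiRatio, ← mul_div_mul_left _ _ (mul_ne_zero hn' hn')]
  congr 1
  · field_simp
    ring
  · field_simp
    ring

/-- For `a, b, δ ≥ 0` the equation
`(1 - x²) ψ'' + ((a + 1) (1 - x) - (b + 1) (1 + x)) ψ' = (δ / 2) ψ` has a solution on `(-1, 1)` that
is positive and nondecreasing (increasing if `δ > 0`) and whose derivative is bounded near `-1`. -/
theorem exists_jacobi_solution {a b δ : ℝ} (ha : 0 ≤ a) (hb : 0 ≤ b) (hδ : 0 ≤ δ) :
    ∃ y y' y'' : ℝ → ℝ,
      (∀ x ∈ Ioo (-1 : ℝ) 1, HasDerivAt y (y' x) x ∧ HasDerivAt y' (y'' x) x ∧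
        (1 - x ^ 2) * y'' x + ((a + 1) * (1 - x) - (b + 1) * (1 + x)) * y' x = δ / 2 * y x ∧
        0 < y x ∧ 0 ≤ y' x ∧ (0 < δ → 0 < y' x)) ∧
      y (-1) = 1 ∧ ContinuousAt y (-1) ∧ ContinuousAt y' (-1) := by
  set c := jacobiCoeff a b δ with hc_def
  have hc : ∀ n, c (n + 1) = jacobiRatio a b δ n * c n := fun n => rfl
  set d := derivCoeff c with hd_def
  set e := derivCoeff d with he_def
  have hρ := tendsto_jacobiRatio a b δ
  have hd := derivCoeff_ratio hc
  have hρ' := tendsto_derivCoeff_ratio hρ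
  have he := derivCoeff_ratio hd
  have hρ'' := tendsto_derivCoeff_ratio hρ'
  have hratio : ∀ n, 0 ≤ jacobiRatio a b δ n := fun n => by unfold jacobiRatio; positivity
  have hc_nonneg : ∀ n, 0 ≤ c n := by
    intro n
    induction n with
    | zero => exact zero_le_one
    | succ n ih => rw [hc]; exact mul_nonneg (hratio n) ih
  have hd_nonneg : ∀ n, 0 ≤ d n := fun n => mul_nonneg (by positivity) (hc_nonneg _)
  have hrec : ∀ n : ℕ, 2 * (n + a + 1) * d n = (n * (n + a + b + 1) + δ / 2) * c n := by
    intro n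
    have h1 : (n : ℝ) + 1 ≠ 0 := by positivity
    have h2 : (n : ℝ) + a + 1 ≠ 0 := by positivity
    rw [hd_def, derivCoeff, hc, jacobiRatio]
    field_simp
  have hderiv : ∀ t : ℝ, |t| < 2 →
      HasDerivAt (fun s => ∑' n, c n * s ^ n) (∑' n, d n * t ^ n) t :=
    fun t ht => hasDerivAt_tsum_pow hc hρ ht
  have hderiv' : ∀ t : ℝ, |t| < 2 →
      HasDerivAt (fun s => ∑' n, d n * s ^ n) (∑' n, e n * t ^ n) t :=
    fun t ht => hasDerivAt_tsum_pow hd hρ' ht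
  have hpos : ∀ (f : ℕ → ℝ) (t : ℝ), (∀ n, 0 ≤ f n) → 0 < f 0 → 0 ≤ t →
      (Summable fun n => f n * t ^ n) → 0 < ∑' n, f n * t ^ n := by
    intro f t hf hf0 ht hs
    exact hs.tsum_pos (fun n => mul_nonneg (hf n) (pow_nonneg ht n)) 0 (by simpa using hf0)
  have hcont : ∀ x : ℝ, |1 + x| < 2 →
      HasDerivAt (fun x => ∑' n, c n * (1 + x) ^ n) (∑' n, d n * (1 + x) ^ n) x :=
    fun x hx => (hderiv (1 + x) hx).comp_const_add 1 x
  have hcont' : ∀ x : ℝ, |1 + x| < 2 →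
      HasDerivAt (fun x => ∑' n, d n * (1 + x) ^ n) (∑' n, e n * (1 + x) ^ n) x :=
    fun x hx => (hderiv' (1 + x) hx).comp_const_add 1 x
  refine ⟨fun x => ∑' n, c n * (1 + x) ^ n, fun x => ∑' n, d n * (1 + x) ^ n,
    fun x => ∑' n, e n * (1 + x) ^ n, fun x hx => ?_, ?_, (hcont _ (by norm_num)).continuousAt,
    (hcont' _ (by norm_num)).continuousAt⟩
  · have hx0 : 0 ≤ 1 + x := by linarith [hx.1]
    have hx2 : |1 + x| < 2 := by rw [abs_of_nonneg hx0]; linarith [hx.2]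
    have sc := summable_of_ratio hc hρ hx2
    have sd := summable_of_ratio hd hρ' hx2
    have se := summable_of_ratio he hρ'' hx2
    refine ⟨hcont x hx2, hcont' x hx2, ?_, hpos c _ hc_nonneg zero_lt_one hx0 sc,
      tsum_nonneg fun n => mul_nonneg (hd_nonneg n) (pow_nonneg hx0 n),
      fun hδ' => hpos d _ hd_nonneg ?_ hx0 sd⟩
    -- With `t = 1 + x`, the equation reads `t (2 - t) y'' + (2 (a + 1) - (a + b + 2) t) y' = (δ /
    -- 2) y`. Here `h1`, `h2`, `h3` are the series of `t y'`, `t y''`, `t² y''`, and the coefficient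
    -- of `tⁿ` is the recurrence `hrec`.
    · have h1 := hasSum_natCast_mul (fun _ => rfl) sd
      have h2 := hasSum_natCast_mul (fun _ => rfl) se
      have h3 : HasSum (fun n : ℕ => (n : ℝ) * ((n - 1) * c n) * (1 + x) ^ n)
          ((1 + x) * ∑' n, (n * d n) * (1 + x) ^ n) := by
        refine hasSum_natCast_mul (fun n => ?_) h2.summable
        simp only [hd_def, derivCoeff]
        push_cast
        ring
      rw [h2.tsum_eq] at h3
      have h4 := ((((h2.mul_left 2).sub h3).add (sd.hasSum.mul_left (2 * (a + 1)))).sub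
        (h1.mul_left (a + b + 2))).sub (sc.hasSum.mul_left (δ / 2))
      have := h4.unique (hasSum_zero.congr_fun fun n => by linear_combination (1 + x) ^ n * hrec n)
      linear_combination this
    · have := hrec 0
      have h0 : c 0 = 1 := rfl
      simp only [Nat.cast_zero, h0] at this
      have ha' : 0 < 2 * (0 + a + 1) := by positivity
      refine pos_of_mul_pos_right ?_ ha'.le
      rw [this]
      linarith
  · have : (fun n => c n * (1 + (-1 : ℝ)) ^ n) = fun n => if n = 0 then 1 else 0 := by
      ext n
      rcases n with _ | n
      · simp [hc_def, jacobiCoeff]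
      · simp
    simp only [this, tsum_ite_eq]

/-! ### The Riccati equation -/

theorem one_sub_sq_pos {x : ℝ} (hx : x ∈ Ioo (-1 : ℝ) 1) : 0 < 1 - x ^ 2 := by
  nlinarith [hx.1, hx.2]

theorem isSolution_iff {c : Fin 3 → ℝ} {U : ℝ → ℝ} :
    IsSolution c U ↔ ∀ x ∈ Ioo (-1 : ℝ) 1,
      HasDerivAt U ((P c x - 2 * x * U x - 1 / 2 * U x ^ 2) / (1 - x ^ 2)) x := by
  refine forall₂_congr fun x hx => ?_
  have hx' := (one_sub_sq_pos hx).ne'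
  constructor
  · rintro ⟨h, h'⟩
    refine HasDerivAt.congr_deriv (h.hasDerivAt) ?_
    rw [eq_div_iff hx']
    linear_combination h'
  · intro h
    refine ⟨h.differentiableAt, ?_⟩
    rw [h.deriv, mul_div_cancel₀ _ hx']
    ring

theorem IsSolution.congr {c : Fin 3 → ℝ} {U V : ℝ → ℝ} (hU : IsSolution c U)
    (h : EqOn V U (Ioo (-1) 1)) : IsSolution c V := by
  rw [isSolution_iff] at *
  intro x hx
  rw [h hx]
  exact (hU x hx).congr_of_eventuallyEq (h.eventuallyEq_of_mem (isOpen_Ioo.mem_nhds hx))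

theorem IsSolution.continuousOn {c : Fin 3 → ℝ} {U : ℝ → ℝ} (hU : IsSolution c U) :
    ContinuousOn U (Ioo (-1) 1) :=
  fun x hx => (hU x hx).1.continuousAt.continuousWithinAt

/-- Bootstrap: the equation expresses `U'` smoothly through `x` and `U`, so each order of regularity
gives the next. -/
theorem IsSolution.contDiffOn {c : Fin 3 → ℝ} {U : ℝ → ℝ} (hU : IsSolution c U) :
    ContDiffOn ℝ ∞ U (Ioo (-1) 1) := by
  rw [contDiffOn_infty]
  intro n
  induction n with
  | zero => exact contDiffOn_zero.2 hU.continuousOn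
  | succ n ih =>
    push_cast
    rw [contDiffOn_succ_iff_deriv_of_isOpen isOpen_Ioo]
    refine ⟨fun x hx => (hU x hx).1.differentiableWithinAt, by simp, ?_⟩
    have : ContDiffOn ℝ n (fun x => (P c x - 2 * x * U x - 1 / 2 * U x ^ 2) / (1 - x ^ 2))
        (Ioo (-1) 1) := by
      refine ContDiffOn.div ?_ (by fun_prop) fun x hx => (one_sub_sq_pos hx).ne'
      unfold P
      fun_prop
    exact this.congr fun x hx => (isSolution_iff.1 hU x hx).deriv

/-- This symmetry exchanges the end points and reverses the order of solutions, so only one end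
point needs analysis. -/
theorem IsSolution.reflect {c : Fin 3 → ℝ} {U : ℝ → ℝ} (hU : IsSolution c U) :
    IsSolution ![c 1, c 0, c 2] fun x => -U (-x) := by
  rw [isSolution_iff] at *
  intro x hx
  have hx' : -x ∈ Ioo (-1 : ℝ) 1 := ⟨by linarith [hx.2], by linarith [hx.1]⟩
  refine HasDerivAt.congr_deriv (((hU (-x) hx').scomp x (hasDerivAt_neg x)).neg) ?_
  simp [P]
  ring

/-- A continuous function on `(-1, 1)` has a primitive. -/
theorem exists_hasDerivAt_of_continuousOn {q : ℝ → ℝ} (hq : ContinuousOn q (Ioo (-1) 1)) :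
    ∃ F : ℝ → ℝ, ∀ x ∈ Ioo (-1 : ℝ) 1, HasDerivAt F (q x) x := by
  refine ⟨fun x => ∫ s in (0 : ℝ)..x, q s, fun x hx => ?_⟩
  refine intervalIntegral.integral_hasDerivAt_right ?_
    (hq.stronglyMeasurableAtFilter isOpen_Ioo x hx) (hq.continuousAt (isOpen_Ioo.mem_nhds hx))
  refine (hq.mono ?_).intervalIntegrable
  exact (ordConnected_Ioo (a := (-1 : ℝ)) (b := 1)).uIcc_subset ⟨by norm_num, by norm_num⟩ hx

/-- The difference of two solutions has a constant sign. -/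
theorem IsSolution.sub_eq {c : Fin 3 → ℝ} {U V : ℝ → ℝ} (hU : IsSolution c U)
    (hV : IsSolution c V) :
    ∃ m : ℝ → ℝ, ∀ x ∈ Ioo (-1 : ℝ) 1, 0 < m x ∧
      ∀ y ∈ Ioo (-1 : ℝ) 1, (V x - U x) * m y = (V y - U y) * m x := by
  have hUc := hU.continuousOn
  have hVc := hV.continuousOn
  -- Subtracting the equations gives `(V - U)' = q (V - U)` with this `q`, so `V - U` is a constant
  -- multiple of `exp F`, where `F' = q`.
  have hq : ContinuousOn (fun x => -((2 * x + (U x + V x) / 2) / (1 - x ^ 2))) (Ioo (-1) 1) :=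
    (ContinuousOn.div (by fun_prop) (by fun_prop) fun x hx => (one_sub_sq_pos hx).ne').neg
  obtain ⟨F, hF⟩ := exists_hasDerivAt_of_continuousOn hq
  rw [isSolution_iff] at hU hV
  have hD : ∀ x ∈ Ioo (-1 : ℝ) 1, HasDerivAt (fun x => (V x - U x) * Real.exp (-F x)) 0 x := by
    intro x hx
    refine HasDerivAt.congr_deriv (((hV x hx).sub (hU x hx)).mul (hF x hx).neg.exp) ?_
    have := (one_sub_sq_pos hx).ne'
    simp only [Pi.sub_apply, Pi.neg_apply]
    field_simp
    ring
  refine ⟨fun x => Real.exp (F x), fun x hx => ⟨Real.exp_pos _, fun y hy => ?_⟩⟩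
  have := isOpen_Ioo.is_const_of_deriv_eq_zero isPreconnected_Ioo
    (fun z hz => (hD z hz).differentiableAt.differentiableWithinAt)
    (fun z hz => (hD z hz).deriv) hx hy
  simp only [Real.exp_neg] at this
  have hx0 := (Real.exp_pos (F x)).ne'
  have hy0 := (Real.exp_pos (F y)).ne'
  field_simp at this
  linear_combination this

theorem IsSolution.lt_of_lt {c : Fin 3 → ℝ} {U V : ℝ → ℝ} (hU : IsSolution c U)
    (hV : IsSolution c V) {x y : ℝ} (hx : x ∈ Ioo (-1 : ℝ) 1) (hy : y ∈ Ioo (-1 : ℝ) 1)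
    (h : U x < V x) : U y < V y := by
  obtain ⟨m, hm⟩ := hU.sub_eq hV
  have h1 := (hm x hx).2 y hy
  have h2 : 0 < (V y - U y) * m x := h1 ▸ mul_pos (sub_pos.2 h) (hm y hy).1
  exact sub_pos.1 (pos_of_mul_pos_left h2 (hm x hx).1.le)

theorem IsSolution.eqOn_of_eq {c : Fin 3 → ℝ} {U V : ℝ → ℝ} (hU : IsSolution c U)
    (hV : IsSolution c V) {x : ℝ} (hx : x ∈ Ioo (-1 : ℝ) 1) (h : U x = V x) :
    EqOn U V (Ioo (-1) 1) := by
  intro y hy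
  rcases lt_trichotomy (U y) (V y) with h' | h' | h'
  · exact absurd h (hU.lt_of_lt hV hy hx h').ne
  · exact h'
  · exact absurd h (hV.lt_of_lt hU hy hx h').ne'

theorem IsSolution.le_of_le {c : Fin 3 → ℝ} {U V : ℝ → ℝ} (hU : IsSolution c U)
    (hV : IsSolution c V) {x y : ℝ} (hx : x ∈ Ioo (-1 : ℝ) 1) (hy : y ∈ Ioo (-1 : ℝ) 1)
    (h : U x ≤ V x) : U y ≤ V y :=
  not_lt.1 fun h' => h.not_gt (hV.lt_of_lt hU hy hx h')

/-- The equation `(1 - x²) G' = (2 x + L) G` has a positive solution. -/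
theorem IsSolution.exists_weight {c : Fin 3 → ℝ} {L : ℝ → ℝ} (hL : IsSolution c L) :
    ∃ G : ℝ → ℝ, ∀ x ∈ Ioo (-1 : ℝ) 1, 0 < G x ∧
      HasDerivAt G ((2 * x + L x) / (1 - x ^ 2) * G x) x := by
  have hLc := hL.continuousOn
  have hq : ContinuousOn (fun x => (2 * x + L x) / (1 - x ^ 2)) (Ioo (-1) 1) :=
    ContinuousOn.div (by fun_prop) (by fun_prop) fun x hx => (one_sub_sq_pos hx).ne'
  obtain ⟨F, hF⟩ := exists_hasDerivAt_of_continuousOn hq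
  refine ⟨fun x => Real.exp (F x), fun x hx => ⟨Real.exp_pos _, ?_⟩⟩
  rw [mul_comm]
  exact (hF x hx).exp

/-- A Riccati equation becomes linear in the reciprocal of the distance to a known solution;
`IsSolution.add_inv` is the converse. -/
theorem IsSolution.hasDerivAt_inv_sub {c : Fin 3 → ℝ} {L U : ℝ → ℝ} (hL : IsSolution c L)
    (hU : IsSolution c U) {x : ℝ} (hx : x ∈ Ioo (-1 : ℝ) 1) (h : U x ≠ L x) :
    HasDerivAt (fun x => (U x - L x)⁻¹)
      (((2 * x + L x) * (U x - L x)⁻¹ + 1 / 2) / (1 - x ^ 2)) x := by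
  have h' := sub_ne_zero.2 h
  refine HasDerivAt.congr_deriv (((isSolution_iff.1 hU x hx).sub (isSolution_iff.1 hL x hx)).inv h') ?_
  have := (one_sub_sq_pos hx).ne'
  simp only [Pi.sub_apply]
  field_simp
  ring

theorem IsSolution.add_inv {c : Fin 3 → ℝ} {L E : ℝ → ℝ} (hL : IsSolution c L)
    (hE : ∀ x ∈ Ioo (-1 : ℝ) 1, E x ≠ 0 ∧
      HasDerivAt E (((2 * x + L x) * E x + 1 / 2) / (1 - x ^ 2)) x) :
    IsSolution c fun x => L x + (E x)⁻¹ := by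
  rw [isSolution_iff] at *
  intro x hx
  refine HasDerivAt.congr_deriv ((hL x hx).add ((hE x hx).2.inv (hE x hx).1)) ?_
  have := (one_sub_sq_pos hx).ne'
  have := (hE x hx).1
  field_simp
  ring

/-- Solutions pass through every point between two solutions. -/
theorem IsSolution.exists_between {c : Fin 3 → ℝ} {L U : ℝ → ℝ} (hL : IsSolution c L)
    (hU : IsSolution c U) {x₀ y : ℝ} (hx₀ : x₀ ∈ Ioo (-1 : ℝ) 1) (hLy : L x₀ ≤ y)
    (hyU : y ≤ U x₀) : ∃ V, IsSolution c V ∧ V x₀ = y := by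
  rcases hLy.eq_or_lt with rfl | hLy
  · exact ⟨L, hL, rfl⟩
  obtain ⟨G, hG⟩ := hL.exists_weight
  have hlt : ∀ x ∈ Ioo (-1 : ℝ) 1, 0 < U x - L x := fun x hx =>
    sub_pos.2 (hL.lt_of_lt hU hx₀ hx (hLy.trans_le hyU))
  -- Chosen so that `(U - L)⁻¹ + k G` equals `(y - L x₀)⁻¹` at `x₀`. As `y ≤ U x₀`, `k ≥ 0`, so this
  -- function stays positive and its reciprocal does not blow up.
  set k := ((y - L x₀)⁻¹ - (U x₀ - L x₀)⁻¹) / G x₀ with hk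
  have hk0 : 0 ≤ k := div_nonneg
    (sub_nonneg.2 (inv_anti₀ (sub_pos.2 hLy) (by linarith))) (hG x₀ hx₀).1.le
  refine ⟨_, hL.add_inv (E := fun x => (U x - L x)⁻¹ + k * G x) fun x hx => ⟨?_, ?_⟩, ?_⟩
  · exact (add_pos_of_pos_of_nonneg (inv_pos.2 (hlt x hx)) (mul_nonneg hk0 (hG x hx).1.le)).ne'
  · refine HasDerivAt.congr_deriv ((hL.hasDerivAt_inv_sub hU hx (sub_pos.1 (hlt x hx)).ne').add
      ((hG x hx).2.const_mul k)) ?_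
    ring
  · simp only [hk, div_mul_cancel₀ _ (hG x₀ hx₀).1.ne', add_sub_cancel, inv_inv]

/-! ### Behaviour at the end points -/

/-- L'Hôpital's rule at a point approached from the left, when the denominator tends to infinity. -/
theorem tendsto_div_of_hasDerivAt {f h h' q : ℝ → ℝ} {a b l : ℝ} (hab : a < b)
    (hh : ∀ x ∈ Ioo a b, 0 ≤ h' x ∧ HasDerivAt h (h' x) x)
    (hf : ∀ x ∈ Ioo a b, HasDerivAt f (q x * h' x) x)
    (hlim : Tendsto h (𝓝[<] b) atTop) (hq : Tendsto q (𝓝[<] b) (𝓝 l)) :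
    Tendsto (fun x => f x / h x) (𝓝[<] b) (𝓝 l) := by
  rw [Metric.tendsto_nhds]
  intro ε hε
  have h1 : ∀ᶠ x in 𝓝[<] b, |q x - l| < ε / 2 := Metric.tendsto_nhds.1 hq _ (half_pos hε)
  obtain ⟨u, hu, hub⟩ := (mem_nhdsLT_iff_exists_Ioo_subset' hab).1
    (inter_mem h1 (Ioo_mem_nhdsLT hab))
  obtain ⟨x₀, hux₀, hx₀b⟩ := _root_.exists_between (mem_Iio.1 hu)
  have hsub : Ico x₀ b ⊆ Ioo u b := fun x hx => ⟨hux₀.trans_le hx.1, hx.2⟩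
  have hder : ∀ (s : ℝ), ∀ x ∈ Ico x₀ b, HasDerivAt (fun x => f x - l * h x + s * h x)
      ((q x - l + s) * h' x) x := by
    intro s x hx
    have hx' := (hub (hsub hx)).2
    refine HasDerivAt.congr_deriv (((hf x hx').sub ((hh x hx').2.const_mul l)).add ((hh x hx').2.const_mul s)) ?_
    ring
  have hanti : AntitoneOn (fun x => f x - l * h x + -(ε / 2) * h x) (Ico x₀ b) := by
    refine antitoneOn_of_deriv_nonpos (convex_Ico _ _)
      (fun x hx => (hder _ x hx).continuousAt.continuousWithinAt)
      (fun x hx => (hder _ x (interior_subset hx)).differentiableAt.differentiableWithinAt) ?_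
    intro x hx
    have hx := interior_subset hx
    rw [(hder _ x hx).deriv]
    have h2 := (abs_lt.1 (mem_ofPred.1 (hub (hsub hx)).1)).2
    exact mul_nonpos_of_nonpos_of_nonneg (by linarith) (hh x (hub (hsub hx)).2).1
  have hmono : MonotoneOn (fun x => f x - l * h x + ε / 2 * h x) (Ico x₀ b) := by
    refine monotoneOn_of_deriv_nonneg (convex_Ico _ _)
      (fun x hx => (hder _ x hx).continuousAt.continuousWithinAt)
      (fun x hx => (hder _ x (interior_subset hx)).differentiableAt.differentiableWithinAt) ?_
    intro x hx
    have hx := interior_subset hx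
    rw [(hder _ x hx).deriv]
    have h2 := (abs_lt.1 (mem_ofPred.1 (hub (hsub hx)).1)).1
    exact mul_nonneg (by linarith) (hh x (hub (hsub hx)).2).1
  -- The two monotonicity statements give `|f - l h| ≤ C + (ε / 2) h`, which is below `ε h` once `h
  -- > 2 C / ε`.
  set C := |f x₀ - l * h x₀| + ε / 2 * |h x₀| with hC
  filter_upwards [Ioo_mem_nhdsLT hx₀b, hlim.eventually_gt_atTop 0,
    hlim.eventually_gt_atTop (2 * C / ε)] with x hx hx0 hxC
  have hl : x₀ ∈ Ico x₀ b := ⟨le_rfl, hx₀b⟩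
  have hr : x ∈ Ico x₀ b := ⟨hx.1.le, hx.2⟩
  have h3 := hanti hl hr hx.1.le
  have h4 := hmono hl hr hx.1.le
  simp only at h3 h4
  rw [div_lt_iff₀ hε] at hxC
  have h5 := abs_le.1 (le_refl |f x₀ - l * h x₀|)
  have h6 : |ε / 2 * h x₀| = ε / 2 * |h x₀| := by rw [abs_mul, abs_of_pos (half_pos hε)]
  have h7 := abs_le.1 h6.le
  rw [Real.dist_eq, div_sub' hx0.ne', abs_div, abs_of_pos hx0, div_lt_iff₀ hx0, abs_lt]
  constructor <;> linarith [h5.1, h5.2, h7.1, h7.2]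

/-- Integrating the bound gives `h x ≥ h 0 - k log (1 - x)`. -/
theorem tendsto_atTop_of_le_deriv {h h' : ℝ → ℝ} {k : ℝ} (hk : 0 < k)
    (hh : ∀ x ∈ Ico (0 : ℝ) 1, k / (1 - x) ≤ h' x ∧ HasDerivAt h (h' x) x) :
    Tendsto h (𝓝[<] 1) atTop := by
  have hder : ∀ x ∈ Ico (0 : ℝ) 1,
      HasDerivAt (fun x => h x + k * Real.log (1 - x)) (h' x - k / (1 - x)) x := by
    intro x hx
    have hx' : 1 - x ≠ 0 := by linarith [hx.2]
    refine HasDerivAt.congr_deriv ((hh x hx).2.add ((((hasDerivAt_id x).const_sub 1).log hx').const_mul k)) ?_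
    simp only [id_eq]
    ring
  have hmono : MonotoneOn (fun x => h x + k * Real.log (1 - x)) (Ico 0 1) := by
    refine monotoneOn_of_deriv_nonneg (convex_Ico _ _)
      (fun x hx => (hder x hx).continuousAt.continuousWithinAt)
      (fun x hx => (hder x (interior_subset hx)).differentiableAt.differentiableWithinAt) ?_
    intro x hx
    rw [(hder x (interior_subset hx)).deriv]
    exact sub_nonneg.2 (hh x (interior_subset hx)).1
  have h1 : Tendsto (fun x : ℝ => 1 - x) (𝓝[<] 1) (𝓝[>] 0) := by
    refine tendsto_nhdsWithin_iff.2 ⟨?_, ?_⟩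
    · have : Tendsto (fun x : ℝ => 1 - x) (𝓝 1) (𝓝 (1 - 1)) := tendsto_id.const_sub 1
      rw [sub_self] at this
      exact this.mono_left nhdsWithin_le_nhds
    · filter_upwards [self_mem_nhdsWithin] with x hx
      exact sub_pos.2 (mem_Iio.1 hx)
  have h2 : Tendsto (fun x : ℝ => h 0 + k * -Real.log (1 - x)) (𝓝[<] 1) atTop :=
    tendsto_atTop_add_const_left _ _
      ((tendsto_neg_atBot_atTop.comp (Real.tendsto_log_nhdsGT_zero.comp h1)).const_mul_atTop hk)
  refine tendsto_atTop_mono' _ ?_ h2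
  filter_upwards [Ioo_mem_nhdsLT (zero_lt_one' ℝ)] with x hx
  have := hmono ⟨le_rfl, zero_lt_one⟩ ⟨hx.1.le, hx.2⟩ hx.1.le
  simp only [sub_zero, Real.log_one, mul_zero, add_zero] at this
  linarith

/-- A solution `L` that tends to `l` at `1`, and stays below a line through `(1, -2)`, is the
least one, and all others tend to `-4 - l`. -/
theorem IsSolution.lt_and_tendsto {c : Fin 3 → ℝ} {L U : ℝ → ℝ} {a l : ℝ} (hL : IsSolution c L)
    (hU : IsSolution c U) (ha : 0 ≤ a)
    (hLa : ∀ x ∈ Ioo (-1 : ℝ) 1, 2 * x + L x ≤ a * (1 - x))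
    (hl : Tendsto L (𝓝[<] 1) (𝓝 l)) (h0 : U 0 ≠ L 0) :
    L 0 < U 0 ∧ Tendsto U (𝓝[<] 1) (𝓝 (-4 - l)) := by
  obtain ⟨G, hG⟩ := hL.exists_weight
  have h00 : (0 : ℝ) ∈ Ioo (-1 : ℝ) 1 := ⟨by norm_num, by norm_num⟩
  have hne : ∀ x ∈ Ioo (-1 : ℝ) 1, U x ≠ L x := fun x hx h => h0 (hU.eqOn_of_eq hL hx h h00)
  have hsub : Ico (0 : ℝ) 1 ⊆ Ioo (-1) 1 := fun x hx => ⟨by linarith [hx.1], hx.2⟩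
  -- By `hLa`, the logarithmic derivative of `G` is at most `a / (1 + x) ≤ a` on `[0, 1)`.
  have hGb : ∀ x ∈ Ico (0 : ℝ) 1, G x ≤ G 0 * Real.exp a := by
    have hder : ∀ x ∈ Ico (0 : ℝ) 1, HasDerivAt (fun x => G x * Real.exp (-(a * x)))
        (((2 * x + L x) / (1 - x ^ 2) - a) * (G x * Real.exp (-(a * x)))) x := by
      intro x hx
      refine HasDerivAt.congr_deriv ((hG x (hsub hx)).2.mul (((hasDerivAt_id x).const_mul a).neg.exp)) ?_
      simp only [id_eq, Pi.neg_apply]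
      ring
    have hanti : AntitoneOn (fun x => G x * Real.exp (-(a * x))) (Ico 0 1) := by
      refine antitoneOn_of_deriv_nonpos (convex_Ico _ _)
        (fun x hx => (hder x hx).continuousAt.continuousWithinAt)
        (fun x hx => (hder x (interior_subset hx)).differentiableAt.differentiableWithinAt) ?_
      intro x hx
      have hx := interior_subset hx
      rw [(hder x hx).deriv]
      refine mul_nonpos_of_nonpos_of_nonneg ?_
        (mul_pos (hG x (hsub hx)).1 (Real.exp_pos _)).le
      rw [sub_nonpos, div_le_iff₀ (one_sub_sq_pos (hsub hx))]
      refine (hLa x (hsub hx)).trans (mul_le_mul_of_nonneg_left ?_ ha)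
      nlinarith [hx.1, hx.2]
    intro x hx
    have h1 := hanti ⟨le_rfl, zero_lt_one⟩ hx hx.1
    simp only [mul_zero, neg_zero, Real.exp_zero, mul_one] at h1
    rw [Real.exp_neg, ← div_eq_mul_inv, div_le_iff₀ (Real.exp_pos _)] at h1
    refine h1.trans (mul_le_mul_of_nonneg_left (Real.exp_le_exp.2 ?_) (hG 0 h00).1.le)
    nlinarith [hx.1, hx.2]
  set h := fun x => (U x - L x)⁻¹ / G x with h_def
  have hh : ∀ x ∈ Ioo (-1 : ℝ) 1, HasDerivAt h (1 / (2 * (1 - x ^ 2) * G x)) x := by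
    intro x hx
    refine HasDerivAt.congr_deriv ((hL.hasDerivAt_inv_sub hU hx (hne x hx)).div (hG x hx).2 (hG x hx).1.ne') ?_
    have := (one_sub_sq_pos hx).ne'
    have := (hG x hx).1.ne'
    have := sub_ne_zero.2 (hne x hx)
    field_simp
    ring
  -- Boundedness of `G` makes `h'` at least a multiple of `1 / (1 - x)`, a non-integrable
  -- singularity.
  have htop : Tendsto h (𝓝[<] 1) atTop := by
    have hM : 0 < G 0 * Real.exp a := mul_pos (hG 0 h00).1 (Real.exp_pos _)
    refine tendsto_atTop_of_le_deriv (k := 1 / (4 * (G 0 * Real.exp a))) (by positivity)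
      fun x hx => ⟨?_, hh x (hsub hx)⟩
    rw [div_div]
    have h1 : 0 < 1 - x := sub_pos.2 hx.2
    have h2 := (hG x (hsub hx)).1
    have h3 := one_sub_sq_pos (hsub hx)
    refine one_div_le_one_div_of_le (by positivity) ?_
    have h4 : 2 * (1 - x ^ 2) ≤ 4 * (1 - x) := by nlinarith [hx.1]
    calc 2 * (1 - x ^ 2) * G x ≤ 4 * (1 - x) * (G 0 * Real.exp a) :=
          mul_le_mul h4 (hGb x hx) h2.le (by positivity)
      _ = _ := by ring
  constructor
  · obtain ⟨x, hx, hx'⟩ := ((htop.eventually_gt_atTop 0).and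
      (Ioo_mem_nhdsLT (show (-1 : ℝ) < 1 by norm_num))).exists
    refine hL.lt_of_lt hU hx' h00 ?_
    have h1 := (hG x hx').1
    have h2 : 0 < (U x - L x)⁻¹ := by
      have := mul_pos hx h1
      simpa only [h_def, div_mul_cancel₀ _ h1.ne'] using this
    exact sub_pos.1 (inv_pos.1 h2)
  -- The quotient is `U - L`, and `(1 / G)' = -2 (2 x + L) h'`, so L'Hôpital's rule applies.
  · have hquot : Tendsto (fun x => (G x)⁻¹ / h x) (𝓝[<] 1) (𝓝 (-2 * (2 * 1 + l))) := by
      refine tendsto_div_of_hasDerivAt (a := -1) (h' := fun x => 1 / (2 * (1 - x ^ 2) * G x))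
        (q := fun x => -2 * (2 * x + L x)) (by norm_num) (fun x hx => ⟨?_, hh x hx⟩)
        (fun x hx => ?_) htop ?_
      · have h2 := (hG x hx).1
        have h3 := one_sub_sq_pos hx
        positivity
      · refine HasDerivAt.congr_deriv ((hG x hx).2.inv (hG x hx).1.ne') ?_
        have := (one_sub_sq_pos hx).ne'
        have := (hG x hx).1.ne'
        field_simp
      · refine Tendsto.const_mul _ (Tendsto.add (Tendsto.const_mul _ ?_) hl)
        exact tendsto_id.mono_left nhdsWithin_le_nhds
    have hsum := hl.add hquot
    rw [show l + -2 * (2 * 1 + l) = -4 - l by ring] at hsum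
    refine hsum.congr' ?_
    filter_upwards [Ioo_mem_nhdsLT (show (-1 : ℝ) < 1 by norm_num)] with x hx
    have h1 := (hG x hx).1.ne'
    have h2 := sub_ne_zero.2 (hne x hx)
    simp only [h_def]
    field_simp
    ring

/-! ### Extremal solutions -/

theorem zero_mem_Ioo : (0 : ℝ) ∈ Ioo (-1 : ℝ) 1 := ⟨by norm_num, by norm_num⟩

/-- The solution for `c₃ = c̄₃(c₁, c₂)`. -/
noncomputable def affineSol (c₁ c₂ x : ℝ) : ℝ :=
  √(1 + c₁) - √(1 + c₂) - (2 + √(1 + c₁) + √(1 + c₂)) * x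

/-- A solution that is regular at `-1` and lies above the affine solution of the critical
equation. -/
theorem exists_solution_ge_affineSol {c : Fin 3 → ℝ} (hc : c ∈ J) :
    ∃ M, IsSolution c M ∧ (∀ x ∈ Ioo (-1 : ℝ) 1, affineSol (c 0) (c 1) x ≤ M x) ∧
      Tendsto M (𝓝[>] (-1)) (𝓝 (τ₂ (c 0))) ∧
      (cbar₃ (c 0) (c 1) < c 2 → affineSol (c 0) (c 1) 0 < M 0) := by
  obtain ⟨h0, h1, h2⟩ := hc
  obtain ⟨y, y', y'', hy, hy1, hyc, hyc'⟩ := exists_jacobi_solution (Real.sqrt_nonneg (1 + c 0))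
    (Real.sqrt_nonneg (1 + c 1)) (sub_nonneg.2 h2)
  have hsa : √(1 + c 0) ^ 2 = 1 + c 0 := Real.sq_sqrt (by linarith)
  have hsb : √(1 + c 1) ^ 2 = 1 + c 1 := Real.sq_sqrt (by linarith)
  refine ⟨fun x => affineSol (c 0) (c 1) x + 2 * (1 - x ^ 2) * (y' x / y x), ?_, ?_, ?_, ?_⟩
  · rw [isSolution_iff]
    intro x hx
    obtain ⟨hy, hy', hode, hpos, -, -⟩ := hy x hx
    unfold affineSol
    refine HasDerivAt.congr_deriv ((((hasDerivAt_id x).const_mul _).const_sub _).add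
      (((((hasDerivAt_id x).pow 2).const_sub 1).const_mul 2).mul (hy'.div hy hpos.ne'))) ?_
    have hx0 := (one_sub_sq_pos hx).ne'
    have hy0 := hpos.ne'
    simp only [id_eq, Pi.pow_apply, P]
    rw [cbar₃] at hode
    have hc0 : c 0 = √(1 + c 0) ^ 2 - 1 := by linarith
    have hc1 : c 1 = √(1 + c 1) ^ 2 - 1 := by linarith
    generalize √(1 + c 0) = a at *
    generalize √(1 + c 1) = b at *
    have hy'' : y'' x = ((c 2 - -(1 / 2) * (a + b) * (a + b + 2)) / 2 * y x -
        ((a + 1) * (1 - x) - (b + 1) * (1 + x)) * y' x) / (1 - x ^ 2) := by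
      rw [eq_div_iff hx0]
      linear_combination hode
    rw [hy'', hc0, hc1]
    field_simp
    ring
  · intro x hx
    obtain ⟨-, -, -, hpos, hnn, -⟩ := hy x hx
    have := one_sub_sq_pos hx
    have : 0 ≤ 2 * (1 - x ^ 2) * (y' x / y x) := by positivity
    linarith
  · have hcont : ContinuousAt
        (fun x => affineSol (c 0) (c 1) x + 2 * (1 - x ^ 2) * (y' x / y x)) (-1) := by
      unfold affineSol
      exact ContinuousAt.add (by fun_prop) (ContinuousAt.mul (by fun_prop)
        (hyc'.div hyc (by rw [hy1]; exact one_ne_zero)))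
    have := hcont.tendsto.mono_left (nhdsWithin_le_nhds (s := Ioi (-1)))
    convert this using 2
    simp only [affineSol, τ₂]
    ring
  · intro hδ
    obtain ⟨-, -, -, hpos, -, hpos'⟩ := hy 0 zero_mem_Ioo
    have := hpos' (sub_pos.2 hδ)
    have : 0 < 2 * (1 - (0 : ℝ) ^ 2) * (y' 0 / y 0) := by
      rw [zero_pow two_ne_zero, sub_zero]
      positivity
    linarith

theorem tendsto_neg_nhdsLT_one : Tendsto (fun x : ℝ => -x) (𝓝[<] 1) (𝓝[>] (-1)) := by
  exact _root_.tendsto_neg_nhdsLT (a := (1 : ℝ))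

theorem tendsto_neg_nhdsGT_neg_one : Tendsto (fun x : ℝ => -x) (𝓝[>] (-1)) (𝓝[<] 1) := by
  simpa using _root_.tendsto_neg_nhdsGT (a := (-1 : ℝ))

theorem reflect_mem_J {c : Fin 3 → ℝ} (hc : c ∈ J) : ![c 1, c 0, c 2] ∈ J := by
  obtain ⟨h0, h1, h2⟩ := hc
  refine ⟨h1, h0, ?_⟩
  simp only [cbar₃, Matrix.cons_val] at h2 ⊢
  linarith

theorem IsSolution.of_reflect {c : Fin 3 → ℝ} {U : ℝ → ℝ} (hU : IsSolution ![c 1, c 0, c 2] U) :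
    IsSolution c fun x => -U (-x) := by
  have h := hU.reflect
  have : c = ![c 0, c 1, c 2] := by ext i; fin_cases i <;> rfl
  rw [this]
  simpa using h

/-- A solution that is regular at `1` and lies below the affine solution of the critical
equation. -/
theorem exists_solution_le_affineSol {c : Fin 3 → ℝ} (hc : c ∈ J) :
    ∃ L, IsSolution c L ∧ (∀ x ∈ Ioo (-1 : ℝ) 1, L x ≤ affineSol (c 0) (c 1) x) ∧
      Tendsto L (𝓝[<] 1) (𝓝 (τ₁' (c 1))) := by
  obtain ⟨M, hM, hge, hlim, -⟩ := exists_solution_ge_affineSol (reflect_mem_J hc)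
  refine ⟨_, hM.of_reflect, fun x hx => ?_, ?_⟩
  · have := hge (-x) ⟨by linarith [hx.2], by linarith [hx.1]⟩
    simp only [affineSol, Matrix.cons_val] at this ⊢
    linarith
  · have := (hlim.comp tendsto_neg_nhdsLT_one).neg
    rwa [show -τ₂ (![c 1, c 0, c 2] 0) = τ₁' (c 1) by
      simp only [τ₁', τ₂, Matrix.cons_val]; ring] at this

/-- For `c ∈ J` there are a least solution `L` and a greatest solution `M`, and all solutions have
the expected limits at the end points. -/
theorem exists_extremal {c : Fin 3 → ℝ} (hc : c ∈ J) :
    ∃ L M, IsSolution c L ∧ IsSolution c M ∧ (cbar₃ (c 0) (c 1) < c 2 → L 0 < M 0) ∧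
      ∀ U, IsSolution c U → L 0 ≤ U 0 ∧ U 0 ≤ M 0 ∧
        Tendsto U (𝓝[>] (-1)) (𝓝 (if U 0 = M 0 then τ₂ (c 0) else τ₁ (c 0))) ∧
        Tendsto U (𝓝[<] 1) (𝓝 (if U 0 = L 0 then τ₁' (c 1) else τ₂' (c 1))) := by
  obtain ⟨L, hL, hLle, hLlim⟩ := exists_solution_le_affineSol hc
  obtain ⟨M, hM, hMge, hMlim, hMlt⟩ := exists_solution_ge_affineSol hc
  have hlow : ∀ U, IsSolution c U → U 0 ≠ L 0 →
      L 0 < U 0 ∧ Tendsto U (𝓝[<] 1) (𝓝 (τ₂' (c 1))) := by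
    intro U hU h0
    -- The bound comes from `2 x + A(x) = a (1 - x) - b (1 + x)` for the affine solution `A`; the
    -- limit is `-4 - τ₁' = τ₂'`.
    have := hL.lt_and_tendsto hU (a := √(1 + c 0)) (Real.sqrt_nonneg _) (fun x hx => ?_) hLlim h0
    · convert this using 3
      simp only [τ₂', τ₁']
      ring
    · have h1 := hLle x hx
      have h2 : 0 ≤ √(1 + c 1) * (1 + x) :=
        mul_nonneg (Real.sqrt_nonneg _) (by linarith [hx.1])
      rw [affineSol] at h1
      linarith
  have hupp : ∀ U, IsSolution c U → U 0 ≠ M 0 →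
      U 0 < M 0 ∧ Tendsto U (𝓝[>] (-1)) (𝓝 (τ₁ (c 0))) := by
    intro U hU h0
    have := hM.reflect.lt_and_tendsto hU.reflect (a := √(1 + c 1)) (Real.sqrt_nonneg _)
      (fun x hx => ?_) (hMlim.comp tendsto_neg_nhdsLT_one).neg (by simpa using h0)
    · simp only [neg_zero, neg_lt_neg_iff] at this
      refine ⟨this.1, ?_⟩
      have h2 := (this.2.comp tendsto_neg_nhdsGT_neg_one).neg
      simp only [Function.comp_def, neg_neg] at h2
      convert h2 using 2
      simp only [τ₂, τ₁]
      ring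
    · have h1 := hMge (-x) ⟨by linarith [hx.2], by linarith [hx.1]⟩
      have h2 : 0 ≤ √(1 + c 0) * (1 + x) :=
        mul_nonneg (Real.sqrt_nonneg _) (by linarith [hx.1])
      rw [affineSol] at h1
      linarith
  refine ⟨L, M, hL, hM, fun h => (hLle 0 zero_mem_Ioo).trans_lt (hMlt h), fun U hU =>
    ⟨?_, ?_, ?_, ?_⟩⟩
  · by_cases h : U 0 = L 0
    · exact h.ge
    · exact (hlow U hU h).1.le
  · by_cases h : U 0 = M 0
    · exact h.le
    · exact (hupp U hU h).1.le
  · split_ifs with h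
    · refine hMlim.congr' ?_
      filter_upwards [Ioo_mem_nhdsGT (show (-1 : ℝ) < 1 by norm_num)] with x hx
      exact (hU.eqOn_of_eq hM zero_mem_Ioo h hx).symm
    · exact (hupp U hU h).2
  · split_ifs with h
    · refine hLlim.congr' ?_
      filter_upwards [Ioo_mem_nhdsLT (show (-1 : ℝ) < 1 by norm_num)] with x hx
      exact (hU.eqOn_of_eq hL zero_mem_Ioo h hx).symm
    · exact (hlow U hU h).2

/-! ### Regular solutions -/

theorem IsSolution.exists_isRegularSolution {c : Fin 3 → ℝ} {U : ℝ → ℝ} (hU : IsSolution c U)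
    {l r : ℝ} (hl : Tendsto U (𝓝[>] (-1)) (𝓝 l)) (hr : Tendsto U (𝓝[<] 1) (𝓝 r)) :
    ∃ V, IsRegularSolution c V ∧ EqOn V U (Ioo (-1) 1) := by
  have heq : EqOn (extendFrom (Ioo (-1) 1) U) U (Ioo (-1) 1) :=
    extendFrom_extends hU.continuousOn
  have hV := hU.congr heq
  exact ⟨_, ⟨hV.contDiffOn, continuousOn_Icc_extendFrom_Ioo hU.continuousOn hl hr, hV⟩, heq⟩

theorem IsRegularSolution.eq_left {c : Fin 3 → ℝ} {U : ℝ → ℝ} (hU : IsRegularSolution c U) {l : ℝ}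
    (hl : Tendsto U (𝓝[>] (-1)) (𝓝 l)) : U (-1) = l := by
  have h := (hU.continuousOn (-1) ⟨le_rfl, by norm_num⟩).mono Ioo_subset_Icc_self
  rw [ContinuousWithinAt, nhdsWithin_Ioo_eq_nhdsGT (by norm_num)] at h
  exact tendsto_nhds_unique h hl

theorem IsRegularSolution.eq_right {c : Fin 3 → ℝ} {U : ℝ → ℝ} (hU : IsRegularSolution c U) {r : ℝ}
    (hr : Tendsto U (𝓝[<] 1) (𝓝 r)) : U 1 = r := by
  have h := (hU.continuousOn 1 ⟨by norm_num, le_rfl⟩).mono Ioo_subset_Icc_self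
  rw [ContinuousWithinAt, nhdsWithin_Ioo_eq_nhdsLT (by norm_num)] at h
  exact tendsto_nhds_unique h hr

theorem IsRegularSolution.eqOn {c : Fin 3 → ℝ} {U V : ℝ → ℝ} (hU : IsRegularSolution c U)
    (hV : IsRegularSolution c V) (h : U 0 = V 0) : EqOn U V (Icc (-1) 1) :=
  (hU.isSolution.eqOn_of_eq hV.isSolution zero_mem_Ioo h).of_subset_closure hU.continuousOn
    hV.continuousOn Ioo_subset_Icc_self (by rw [closure_Ioo (by norm_num)])

theorem Uplus_spec {c : Fin 3 → ℝ} (h : ∃ V, IsUpperSolution c V) :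
    IsUpperSolution c (Uplus c) := by
  rw [Uplus, dif_pos h]
  exact h.choose_spec

theorem Uminus_spec {c : Fin 3 → ℝ} (h : ∃ V, IsLowerSolution c V) :
    IsLowerSolution c (Uminus c) := by
  rw [Uminus, dif_pos h]
  exact h.choose_spec

theorem Uθ_spec {c : Fin 3 → ℝ} {γ : ℝ} (h : ∃ U, IsRegularSolution c U ∧ U 0 = γ) :
    IsRegularSolution c (Uθ c γ) ∧ Uθ c γ 0 = γ := by
  rw [Uθ, dif_pos h]
  exact h.choose_spec

end AxiNS

open AxiNS

theorem theorem1p3 (c : Fin 3 → ℝ) (hc : c ∈ AxiNS.J) :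
    -- the objects in the statement are well defined
    AxiNS.IsUpperSolution c (AxiNS.Uplus c) ∧
    AxiNS.IsLowerSolution c (AxiNS.Uminus c) ∧
    (∀ γ : ℝ, (c, γ) ∈ AxiNS.I →
      AxiNS.IsRegularSolution c (AxiNS.Uθ c γ) ∧ AxiNS.Uθ c γ 0 = γ ∧
        ∀ V : ℝ → ℝ, AxiNS.IsRegularSolution c V → V 0 = γ →
          Set.EqOn V (AxiNS.Uθ c γ) (Set.Icc (-1) 1)) ∧
    -- (i)
    (AxiNS.cbar₃ (c 0) (c 1) < c 2 →
      AxiNS.γminus c < AxiNS.γplus c ∧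
      (∀ γ γ' : ℝ, AxiNS.γminus c ≤ γ → γ < γ' → γ' ≤ AxiNS.γplus c →
        ∀ x ∈ Set.Ioo (-1 : ℝ) 1, AxiNS.Uθ c γ x < AxiNS.Uθ c γ' x) ∧
      {p : ℝ × ℝ | p.1 ∈ Set.Ioo (-1 : ℝ) 1 ∧
          AxiNS.Uθ c (AxiNS.γminus c) p.1 ≤ p.2 ∧ p.2 ≤ AxiNS.Uθ c (AxiNS.γplus c) p.1} =
        ⋃ γ ∈ Set.Icc (AxiNS.γminus c) (AxiNS.γplus c),
          {p : ℝ × ℝ | p.1 ∈ Set.Ioo (-1 : ℝ) 1 ∧ p.2 = AxiNS.Uθ c γ p.1}) ∧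
    -- (ii)
    (∀ γ : ℝ, (c, γ) ∈ AxiNS.I →
      (γ = AxiNS.γplus c → AxiNS.Uθ c γ (-1) = AxiNS.τ₂ (c 0)) ∧
      (γ ≠ AxiNS.γplus c → AxiNS.Uθ c γ (-1) = AxiNS.τ₁ (c 0)) ∧
      (γ = AxiNS.γminus c → AxiNS.Uθ c γ 1 = AxiNS.τ₁' (c 1)) ∧
      (γ ≠ AxiNS.γminus c → AxiNS.Uθ c γ 1 = AxiNS.τ₂' (c 1))) := by
  obtain ⟨L, M, hL, hM, hlt, hall⟩ := exists_extremal hc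
  have hreg : ∀ U, IsSolution c U → ∃ V, IsRegularSolution c V ∧ EqOn V U (Ioo (-1) 1) :=
    fun U hU => hU.exists_isRegularSolution (hall U hU).2.2.1 (hall U hU).2.2.2
  have hplus : IsUpperSolution c (Uplus c) := by
    obtain ⟨V, hV, hVM⟩ := hreg M hM
    refine Uplus_spec ⟨V, hV, fun U hU x hx => ?_⟩
    rw [hVM hx]
    exact hU.le_of_le hM zero_mem_Ioo hx (hall U hU).2.1
  have hminus : IsLowerSolution c (Uminus c) := by
    obtain ⟨V, hV, hVL⟩ := hreg L hL
    refine Uminus_spec ⟨V, hV, fun U hU x hx => ?_⟩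
    rw [hVL hx]
    exact hL.le_of_le hU zero_mem_Ioo hx (hall U hU).1
  have hγM : γplus c = M 0 :=
    (hall _ hplus.1.isSolution).2.1.antisymm (hplus.2 M hM 0 zero_mem_Ioo)
  have hγL : γminus c = L 0 :=
    (hminus.2 L hL 0 zero_mem_Ioo).antisymm (hall _ hminus.1.isSolution).1
  have hU : ∀ γ, γminus c ≤ γ → γ ≤ γplus c →
      IsRegularSolution c (Uθ c γ) ∧ Uθ c γ 0 = γ := by
    intro γ h1 h2
    obtain ⟨V, hV, hV0⟩ := hL.exists_between hM zero_mem_Ioo (hγL ▸ h1) (hγM ▸ h2)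
    obtain ⟨W, hW, hWV⟩ := hreg V hV
    exact Uθ_spec ⟨W, hW, (hWV zero_mem_Ioo).trans hV0⟩
  refine ⟨hplus, hminus, ?_, fun hc3 => ⟨?_, ?_, ?_⟩, ?_⟩
  · rintro γ ⟨-, h1, h2⟩
    obtain ⟨h3, h4⟩ := hU γ h1 h2
    exact ⟨h3, h4, fun V hV hV0 => hV.eqOn h3 (hV0.trans h4.symm)⟩
  · rw [hγL, hγM]
    exact hlt hc3
  · intro γ γ' h1 h2 h3 x hx
    obtain ⟨h4, h5⟩ := hU γ h1 (h2.le.trans h3)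
    obtain ⟨h6, h7⟩ := hU γ' (h1.trans h2.le) h3
    exact h4.isSolution.lt_of_lt h6.isSolution zero_mem_Ioo hx (by rwa [h5, h7])
  · have hle : γminus c ≤ γplus c := by
      rw [hγL, hγM]
      exact (hlt hc3).le
    obtain ⟨h1, h2⟩ := hU _ le_rfl hle
    obtain ⟨h3, h4⟩ := hU _ hle le_rfl
    ext ⟨x, y⟩
    simp only [mem_ofPred_eq, mem_iUnion, exists_prop, mem_Icc]
    constructor
    · rintro ⟨hx, hy1, hy2⟩
      -- The curve through `(x, y)` is labelled by its value at `0`.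
      obtain ⟨V, hV, hVx⟩ := h1.isSolution.exists_between h3.isSolution hx hy1 hy2
      have h5 : γminus c ≤ V 0 := hγL ▸ (hall V hV).1
      have h6 : V 0 ≤ γplus c := hγM ▸ (hall V hV).2.1
      obtain ⟨h7, h8⟩ := hU _ h5 h6
      refine ⟨V 0, ⟨h5, h6⟩, hx, ?_⟩
      rw [← hVx]
      exact hV.eqOn_of_eq h7.isSolution zero_mem_Ioo h8.symm hx
    · rintro ⟨γ, ⟨h5, h6⟩, hx, rfl⟩
      obtain ⟨h7, h8⟩ := hU γ h5 h6
      exact ⟨hx, h1.isSolution.le_of_le h7.isSolution zero_mem_Ioo hx (by rwa [h2, h8]),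
        h7.isSolution.le_of_le h3.isSolution zero_mem_Ioo hx (by rwa [h4, h8])⟩
  · rintro γ ⟨-, h1, h2⟩
    obtain ⟨h3, h4⟩ := hU γ h1 h2
    obtain ⟨-, -, hl, hr⟩ := hall _ h3.isSolution
    rw [h4, ← hγM] at hl
    rw [h4, ← hγL] at hr
    have hl := h3.eq_left hl
    have hr := h3.eq_right hr
    exact ⟨fun h => hl.trans (if_pos h), fun h => hl.trans (if_neg h),
      fun h => hr.trans (if_pos h), fun h => hr.trans (if_neg h)⟩
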